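/- Let $G$ be a (not necessarily finite) group and $\mathbb{Z}G$ its integral group ring. For $x,h\in G$ with $h$ of finite order $d$, put $$\beta_{x,h}=1+(1-h)\,x\,(1+h+h^2+\cdots+h^{d-1}),\qquad \gamma_{x,h}=1+(1+h+h^2+\cdots+h^{d-1})\,x\,(1-h).$$ These elements are units of $\mathbb{Z}G$, called the bicyclic units of type $\beta$ and of type $\gamma$, respectively. If $\alpha$ is a bicyclic unit of $\mathbb{Z}G$ (of either type) with $\alpha\neq 1$, then there exist a bicyclic unit $\beta$ of type $\beta$ and a bicyclic unit $\gamma$ of type $\gamma$ in $\mathbb{Z}G$ such that the subgroups $\langle\alpha,\beta\rangle$ and $\langle\alpha,\gamma\rangle$ of the unit group of $\mathbb{Z}G$ are both non-abelian free groups. -/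

import Mathlib

namespace BicyclicUnits

variable {G : Type*} [Group G]

/-- The sum `1 + h + h ^ 2 + ⋯ + h ^ (d - 1)` in `ℤG`, where `d` is the order of `h`. -/
noncomputable def cyclicSum (h : G) : MonoidAlgebra ℤ G :=
  ∑ i ∈ Finset.range (orderOf h), MonoidAlgebra.of ℤ G h ^ i

theorem cyclicSum_mul_one_sub (h : G) :
    cyclicSum h * (1 - MonoidAlgebra.of ℤ G h) = 0 := by
  rw [cyclicSum, geom_sum_mul_neg, ← map_pow, pow_orderOf_eq_one, map_one, sub_self]

/-- The element `(1 - h) x (1 + h + ⋯ + h ^ (d - 1))` of `ℤG`. -/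
noncomputable def betaNil (x h : G) : MonoidAlgebra ℤ G :=
  (1 - MonoidAlgebra.of ℤ G h) * MonoidAlgebra.of ℤ G x * cyclicSum h

/-- The element `(1 + h + ⋯ + h ^ (d - 1)) x (1 - h)` of `ℤG`. -/
noncomputable def gammaNil (x h : G) : MonoidAlgebra ℤ G :=
  cyclicSum h * MonoidAlgebra.of ℤ G x * (1 - MonoidAlgebra.of ℤ G h)

theorem betaNil_mul_self (x h : G) : betaNil x h * betaNil x h = 0 := by
  simp only [betaNil, mul_assoc]
  rw [← mul_assoc (cyclicSum h), cyclicSum_mul_one_sub]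
  simp

theorem gammaNil_mul_self (x h : G) : gammaNil x h * gammaNil x h = 0 := by
  have e : (1 - MonoidAlgebra.of ℤ G h) * cyclicSum h = 0 := by
    rw [cyclicSum, mul_neg_geom_sum, ← map_pow, pow_orderOf_eq_one, map_one, sub_self]
  simp only [gammaNil, mul_assoc]
  rw [← mul_assoc (1 - MonoidAlgebra.of ℤ G h), e]
  simp

/-- The unit `β_{x,h} = 1 + (1 - h) x (1 + h + ⋯ + h ^ (d - 1))` of `ℤG`. -/
noncomputable def beta (x h : G) : (MonoidAlgebra ℤ G)ˣ where
  val := 1 + betaNil x h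
  inv := 1 - betaNil x h
  val_inv := by
    have := betaNil_mul_self x h
    simp [mul_sub, add_mul, this]
  inv_val := by
    have := betaNil_mul_self x h
    simp [mul_add, sub_mul, this]

/-- The unit `γ_{x,h} = 1 + (1 + h + ⋯ + h ^ (d - 1)) x (1 - h)` of `ℤG`. -/
noncomputable def gamma (x h : G) : (MonoidAlgebra ℤ G)ˣ where
  val := 1 + gammaNil x h
  inv := 1 - gammaNil x h
  val_inv := by
    have := gammaNil_mul_self x h
    simp [mul_sub, add_mul, this]
  inv_val := by
    have := gammaNil_mul_self x h
    simp [mul_add, sub_mul, this]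

/-- `u` is a bicyclic unit of type `β`. -/
def IsBetaType (u : (MonoidAlgebra ℤ G)ˣ) : Prop :=
  ∃ x h : G, IsOfFinOrder h ∧ u = beta x h

/-- `u` is a bicyclic unit of type `γ`. -/
def IsGammaType (u : (MonoidAlgebra ℤ G)ˣ) : Prop :=
  ∃ x h : G, IsOfFinOrder h ∧ u = gamma x h

/-- `u` is a bicyclic unit. -/
def IsBicyclic (u : (MonoidAlgebra ℤ G)ˣ) : Prop :=
  IsBetaType u ∨ IsGammaType u

/-- `(u, v)` is a free pair: the subgroup generated by `u` and `v` is a non-abelian free group. -/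
def IsFreePair {U : Type*} [Group U] (u v : U) : Prop :=
  IsFreeGroup (Subgroup.closure ({u, v} : Set U)) ∧
    ∃ a b : Subgroup.closure ({u, v} : Set U), a * b ≠ b * a

end BicyclicUnits

namespace BicyclicUnits

open scoped InnerProductSpace ComplexConjugate

/-! Every bicyclic unit is 1 + a with a² = 0. If a² = b² = 0, then 1 + a and 1 + b act on the
elements ab·p(ab) + b·q(ab) through the shears (p, q) ↦ (p + q, q) and (p, q) ↦ (p, q + Xp). If some
z with |z| ≥ 4 is a root of every polynomial killing ab, setting X = z turns these into shears of
ℂ², which generate freely by ping-pong (`injective_lift_of_common_root`).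

Such a z is found by a trace argument. ℤG acts on ℓ²(G) by left translation, and τ reads off the
coefficient of 1. If h of order d fixes ab on the left, then ab takes values in the h-fixed vectors,
a space of von Neumann dimension at most 1/d. If all roots of a monic polynomial killing ab had
modulus at most r, then d|τ(ab)| ≤ r (`norm_tau_le`). Hence d|τ(ab)| ≥ 4 suffices
(`exists_common_root`); the case where h fixes on the right reduces to this one by averaging.

With k = xhx⁻¹, the condition β_{x,h} ≠ 1 forces h ∉ ⟨k⟩. Against γ_{x⁻¹,h} or β_{x⁻¹,k} the trace
then has real part at least d ≥ 2 (`coeffOne_sq_re`, `orderOf_le_coeffOne_re`), so d|τ(ab)| ≥ d² ≥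
4. Type γ is the mirror image. -/

/-- The Hilbert space `ℓ²(G)`. -/
noncomputable abbrev L2 (G : Type*) : Type _ := lp (fun _ : G => ℂ) 2

/-! ### The trace on right-invariant operators of ℓ²(G). -/

section Hilbert

variable {G : Type*}

/-- A permutation of `G` acts on `ℓ²(G)` isometrically. -/
noncomputable def permIsometry (σ : Equiv.Perm G) : L2 G →ₗᵢ[ℂ] L2 G where
  toFun ξ := ⟨fun s => ξ (σ⁻¹ s), 
    (memℓp_gen_iff (by simp)).2
      ((Equiv.summable_iff σ⁻¹).2 ((memℓp_gen_iff (by simp)).1 (lp.memℓp ξ)))⟩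
  map_add' _ _ := rfl
  map_smul' _ _ := rfl
  norm_map' ξ := by
    rw [lp.norm_eq_tsum_rpow (by simp), lp.norm_eq_tsum_rpow (by simp)]
    congr 1
    exact (σ⁻¹ : Equiv.Perm G).tsum_eq fun s => ‖ξ s‖ ^ (2 : ENNReal).toReal

/-- The representation of the permutation group of `G` on `ℓ²(G)`. -/
noncomputable def permRep (G : Type*) : Equiv.Perm G →* (L2 G →L[ℂ] L2 G) where
  toFun σ := (permIsometry σ).toContinuousLinearMap
  map_one' := rfl
  map_mul' σ τ := by
    ext ξ s
    change ξ ((σ * τ)⁻¹ s) = ξ (τ⁻¹ (σ⁻¹ s))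
    rw [mul_inv_rev, Equiv.Perm.mul_apply]

theorem inner_permRep (σ : Equiv.Perm G) (ξ η : L2 G) :
    ⟪permRep G σ ξ, permRep G σ η⟫_ℂ = ⟪ξ, η⟫_ℂ :=
  (permIsometry σ).inner_map_map ξ η

open scoped Classical in
/-- The basis vector of `ℓ²(G)` at `s`. -/
noncomputable def delta (s : G) : L2 G := lp.single 2 s (1 : ℂ)

theorem inner_delta (s : G) (ξ : L2 G) : ⟪delta s, ξ⟫_ℂ = ξ s := by
  classical
  rw [delta, lp.inner_single_left]
  simp

theorem delta_apply_self (s : G) : delta s s = 1 := by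
  simp [delta]

theorem delta_apply_of_ne {s t : G} (h : t ≠ s) : delta s t = 0 := by
  simp [delta, h]

variable [Group G]

/-- Left translation by group elements on `ℓ²(G)`. -/
noncomputable def leftRep (G : Type*) [Group G] : G →* (L2 G →L[ℂ] L2 G) :=
  (permRep G).comp (MulAction.toPermHom G G)

/-- Right translation by `g` on `ℓ²(G)`. -/
noncomputable def rightTrans (g : G) : L2 G →L[ℂ] L2 G := permRep G (Equiv.mulRight g)

theorem leftRep_apply (g : G) (ξ : L2 G) (s : G) : leftRep G g ξ s = ξ (g⁻¹ * s) := rfl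

theorem rightTrans_apply (g : G) (ξ : L2 G) (s : G) : rightTrans g ξ s = ξ (s * g⁻¹) := rfl

theorem inner_rightTrans (g : G) (ξ η : L2 G) :
    ⟪rightTrans g ξ, rightTrans g η⟫_ℂ = ⟪ξ, η⟫_ℂ := inner_permRep _ _ _

theorem rightTrans_mul_inv (g : G) (ξ : L2 G) : rightTrans g (rightTrans g⁻¹ ξ) = ξ := by
  ext s
  simp [rightTrans_apply]

theorem rightTrans_delta_one (g : G) : rightTrans g (delta 1) = delta g := by
  ext s
  rw [rightTrans_apply]
  by_cases h : s = g
  · subst h; simp [delta_apply_self]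
  · rw [delta_apply_of_ne h, delta_apply_of_ne]
    simpa [mul_inv_eq_one] using h

/-- The operator `X` on `ℓ²(G)` commutes with right translations. -/
def IsRightInvariant (X : L2 G →L[ℂ] L2 G) : Prop :=
  ∀ g ξ, X (rightTrans g ξ) = rightTrans g (X ξ)

theorem IsRightInvariant.mul {X Y : L2 G →L[ℂ] L2 G} (hX : IsRightInvariant X)
    (hY : IsRightInvariant Y) : IsRightInvariant (X * Y) := fun g ξ => by
  rw [mul_apply_eq_comp, hY, hX]; rfl

/-- The trace `X ↦ ⟨δ, X δ⟩`. -/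
noncomputable def tau (G : Type*) [Group G] : (L2 G →L[ℂ] L2 G) →ₗ[ℂ] ℂ where
  toFun X := X (delta 1) 1
  map_add' _ _ := rfl
  map_smul' _ _ := rfl

theorem tau_eq_inner (X : L2 G →L[ℂ] L2 G) : tau G X = ⟪delta 1, X (delta 1)⟫_ℂ :=
  (inner_delta _ _).symm

/-- Right invariance recovers the whole matrix of X from X δ₁: ⟨δ₁, X δ_s⟩ = (X δ₁)(s⁻¹). The sum is
symmetric in X and Y under s ↦ s⁻¹, which gives the trace property. -/
theorem tau_mul_eq_tsum {X : L2 G →L[ℂ] L2 G} (hX : IsRightInvariant X) (Y : L2 G →L[ℂ] L2 G) :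
    tau G (X * Y) = ∑' s, X (delta 1) s⁻¹ * Y (delta 1) s := by
  rw [tau_eq_inner, mul_apply_eq_comp, ← ContinuousLinearMap.adjoint_inner_left,
    lp.inner_eq_tsum]
  refine tsum_congr fun s => ?_
  rw [RCLike.inner_apply, mul_comm, ← inner_delta s (X.adjoint _), inner_conj_symm,
    ContinuousLinearMap.adjoint_inner_left, inner_delta, ← rightTrans_delta_one s, hX,
    rightTrans_apply, one_mul]

theorem tau_mul_comm {X Y : L2 G →L[ℂ] L2 G} (hX : IsRightInvariant X) (hY : IsRightInvariant Y) :
    tau G (X * Y) = tau G (Y * X) := by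
  rw [tau_mul_eq_tsum hX, tau_mul_eq_tsum hY, ← (Equiv.inv G).tsum_eq]
  refine tsum_congr fun s => ?_
  rw [Equiv.inv_apply, inv_inv, mul_comm]

/-- A subspace of `ℓ²(G)` is invariant under right translations. -/
def IsRightStable (I : Submodule ℂ (L2 G)) : Prop := ∀ g, ∀ v ∈ I, rightTrans g v ∈ I

theorem IsRightStable.starProjection {I : Submodule ℂ (L2 G)} [I.HasOrthogonalProjection]
    (hI : IsRightStable I) : IsRightInvariant I.starProjection := fun g ξ => by
  apply Submodule.eq_starProjection_of_mem_of_inner_eq_zero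
  · exact hI g _ (Submodule.starProjection_apply_mem _ _)
  · intro w hw
    rw [← map_sub, ← rightTrans_mul_inv g w, inner_rightTrans]
    exact Submodule.starProjection_inner_eq_zero _ _ (hI _ _ hw)

/-- For right-stable I this number is the von Neumann dimension of I; the formula shows it is real
and nonnegative. -/
theorem tau_starProjection (I : Submodule ℂ (L2 G)) [I.HasOrthogonalProjection] :
    tau G I.starProjection = ((‖I.starProjection (delta 1)‖ ^ 2 : ℝ) : ℂ) := by
  rw [tau_eq_inner]
  conv_lhs => rw [← (Submodule.isIdempotentElem_starProjection I).eq]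
  rw [mul_apply_eq_comp, ← Submodule.inner_starProjection_left_eq_right,
    inner_self_eq_norm_sq_to_K]
  norm_cast

/-- One step of a filtration: if `T - μ` maps `I` into `J ≤ I`, the traces of `T` on `I` and `J`
differ by `μ` times the difference of dimensions. -/
theorem tau_mul_starProjection_sub {T : L2 G →L[ℂ] L2 G} (hT : IsRightInvariant T)
    {I J : Submodule ℂ (L2 G)} [I.HasOrthogonalProjection] [J.HasOrthogonalProjection]
    (hJ : IsRightStable J) (hI : IsRightStable I) (hJI : J ≤ I) {μ : ℂ}
    (h : ∀ v ∈ I, T v - μ • v ∈ J) :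
    tau G (T * I.starProjection) - tau G (T * J.starProjection) =
      μ * (tau G I.starProjection - tau G J.starProjection) := by
  set E := I.starProjection
  set F := J.starProjection
  set S : L2 G →L[ℂ] L2 G := T - μ • 1 with hS
  have hSr : IsRightInvariant S := fun g ξ => by simp [hS, hT g ξ]
  have hE : IsRightInvariant E := hI.starProjection
  have hF : IsRightInvariant F := hJ.starProjection
  have h1 : S * E = F * (S * E) := by
    ext1 v
    refine (Submodule.starProjection_eq_self_iff.2 ?_).symm
    simpa [hS] using h _ (Submodule.starProjection_apply_mem _ _)
  have h2 : E * F = F := by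
    ext1 v
    exact Submodule.starProjection_eq_self_iff.2 (hJI (Submodule.starProjection_apply_mem _ _))
  -- Trace property: τ(SE) = τ(FSE) = τ(SEF) = τ(SF).
  have h3 : tau G (S * E) = tau G (S * F) := by
    rw [h1, tau_mul_comm hF (hSr.mul hE), mul_assoc, h2]
  have h4 : ∀ Z : L2 G →L[ℂ] L2 G, tau G (S * Z) = tau G (T * Z) - μ * tau G Z := fun Z => by
    rw [hS, sub_mul, smul_mul_assoc, one_mul, map_sub, map_smul, smul_eq_mul]
  rw [h4, h4] at h3
  linear_combination h3

end Hilbert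

open scoped InnerProductSpace Polynomial

/-! ### From a large trace to a large common root. -/

section Spectral

variable {G : Type*} [Group G]

theorem isRightInvariant_leftRep (g : G) : IsRightInvariant (leftRep G g) := fun k ξ => by
  ext s
  simp only [leftRep_apply, rightTrans_apply, mul_assoc]

theorem IsRightInvariant.aeval {T : L2 G →L[ℂ] L2 G} (hT : IsRightInvariant T) (f : ℂ[X]) :
    IsRightInvariant (Polynomial.aeval T f) := by
  induction f using Polynomial.induction_on' with
  | add p q hp hq => intro g ξ; simp [hp g ξ, hq g ξ]
  | monomial n c =>
    have hn : IsRightInvariant (T ^ n) := by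
      induction n with
      | zero => intro g ξ; simp
      | succ n ih => rw [pow_succ]; exact ih.mul hT
    intro g ξ
    simp [Polynomial.aeval_monomial, Algebra.algebraMap_eq_smul_one, hn g ξ]

/-- If `T` is killed on `I` by a product of linear factors, its trace on `I` is bounded by
the largest root times the dimension of `I`. -/
theorem norm_tau_mul_starProjection_le {T : L2 G →L[ℂ] L2 G} (hT : IsRightInvariant T) {r : ℝ}
    (L : Multiset ℂ) (hL : ∀ μ ∈ L, ‖μ‖ ≤ r) (I : Submodule ℂ (L2 G)) [I.HasOrthogonalProjection]
    (hIc : IsClosed (I : Set (L2 G))) (hI : IsRightStable I) (hTI : ∀ v ∈ I, T v ∈ I)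
    (hk : ∀ v ∈ I, Polynomial.aeval T (L.map fun μ => Polynomial.X - Polynomial.C μ).prod v = 0) :
    ‖tau G (T * I.starProjection)‖ ≤ r * ‖I.starProjection (delta 1)‖ ^ 2 := by
  induction L using Multiset.induction_on generalizing I with
  | empty =>
    have h0 : I = ⊥ := by
      rw [eq_bot_iff]
      intro v hv
      simpa using hk v hv
    subst h0
    simp
  | cons μ L ih =>
    set S : L2 G →L[ℂ] L2 G := T - μ • 1 with hS
    have hSv : ∀ v, S v = T v - μ • v := fun v => by simp [hS]
    have hTS : ∀ v, T (S v) = S (T v) := fun v => by simp [hSv]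
    -- One linear factor is used up in passing to the closure J of (T - μ)I: the remaining factors
    -- kill J, so the induction hypothesis applies there.
    set J : Submodule ℂ (L2 G) := (I.map (S : L2 G →ₗ[ℂ] L2 G)).topologicalClosure with hJdef
    have hJc : IsClosed (J : Set (L2 G)) := Submodule.isClosed_topologicalClosure _
    have hmem : ∀ v ∈ I, S v ∈ J := fun v hv =>
      Submodule.le_topologicalClosure _ (Submodule.mem_map_of_mem hv)
    have hmin : ∀ K : Submodule ℂ (L2 G), IsClosed (K : Set (L2 G)) → (∀ v ∈ I, S v ∈ K) →
        J ≤ K := fun K hK h =>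
      Submodule.topologicalClosure_minimal _ (Submodule.map_le_iff_le_comap.2 h) hK
    have hcomap : ∀ X : L2 G →L[ℂ] L2 G, (∀ v ∈ I, X (S v) ∈ J) → ∀ v ∈ J, X v ∈ J := fun X h =>
      hmin (J.comap (X : L2 G →ₗ[ℂ] L2 G)) (hJc.preimage X.continuous) h
    have hJI : J ≤ I := hmin I hIc fun v hv => by
      rw [hSv]
      exact I.sub_mem (hTI v hv) (I.smul_mem _ hv)
    have hJ : IsRightStable J := fun g => hcomap (rightTrans g) fun v hv => by
      have : rightTrans g (S v) = S (rightTrans g v) := by rw [hSv, hSv, hT, map_sub, map_smul]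
      rw [this]
      exact hmem _ (hI g v hv)
    have hTJ : ∀ v ∈ J, T v ∈ J := hcomap T fun v hv => by
      rw [hTS]
      exact hmem _ (hTI v hv)
    have hkJ : ∀ v ∈ J,
        Polynomial.aeval T (L.map fun μ => Polynomial.X - Polynomial.C μ).prod v = 0 := by
      set Q := Polynomial.aeval T (L.map fun μ => Polynomial.X - Polynomial.C μ).prod with hQ
      have := hmin (LinearMap.ker (Q : L2 G →ₗ[ℂ] L2 G)) (isClosed_singleton.preimage Q.continuous)
        fun v hv => by
          have := hk v hv
          rw [Multiset.map_cons, Multiset.prod_cons, mul_comm, map_mul] at this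
          rw [LinearMap.mem_ker]
          simpa [hSv, Algebra.algebraMap_eq_smul_one] using this
      exact fun v hv => LinearMap.mem_ker.1 (this hv)
    have h1 := ih (fun ν hν => hL ν (Multiset.mem_cons_of_mem hν)) J hJc hJ hTJ hkJ
    have h2 := tau_mul_starProjection_sub hT hJ hI hJI (μ := μ) fun v hv => by
      rw [← hSv]; exact hmem v hv
    rw [tau_starProjection, tau_starProjection, ← Complex.ofReal_sub] at h2
    have h3 : ‖J.starProjection (delta 1)‖ ^ 2 ≤ ‖I.starProjection (delta 1)‖ ^ 2 := by
      have : J.starProjection (delta 1) = J.starProjection (I.starProjection (delta 1)) :=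
        (congrArg (fun X : L2 G →L[ℂ] L2 G => X (delta 1))
          (Submodule.starProjection_comp_starProjection_of_le hJI)).symm
      rw [this]
      gcongr
      exact Submodule.norm_starProjection_apply_le _ _
    have hμ := hL μ (Multiset.mem_cons_self _ _)
    have h4 : tau G (T * I.starProjection) = tau G (T * J.starProjection) +
        μ * ((‖I.starProjection (delta 1)‖ ^ 2 - ‖J.starProjection (delta 1)‖ ^ 2 : ℝ) : ℂ) := by
      linear_combination h2
    rw [h4]
    refine (norm_add_le _ _).trans ?_
    rw [norm_mul, Complex.norm_real, Real.norm_of_nonneg (sub_nonneg.2 h3)]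
    have h5 := mul_le_mul_of_nonneg_right hμ (sub_nonneg.2 h3)
    linarith

/-- The fixed vectors of left translation by `h`. -/
noncomputable def fixedVectors (h : G) : Submodule ℂ (L2 G) :=
  LinearMap.ker ((leftRep G h - 1 : L2 G →L[ℂ] L2 G) : L2 G →ₗ[ℂ] L2 G)

theorem mem_fixedVectors {h : G} {v : L2 G} : v ∈ fixedVectors h ↔ leftRep G h v = v := by
  rw [fixedVectors, LinearMap.mem_ker]
  simp [sub_eq_zero]

theorem isClosed_fixedVectors (h : G) : IsClosed (fixedVectors h : Set (L2 G)) :=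
  isClosed_singleton.preimage (leftRep G h - 1 : L2 G →L[ℂ] L2 G).continuous

theorem isRightStable_fixedVectors (h : G) : IsRightStable (fixedVectors h) := fun g v hv => by
  rw [mem_fixedVectors] at hv ⊢
  rw [isRightInvariant_leftRep, hv]

instance (h : G) : (fixedVectors h).HasOrthogonalProjection :=
  haveI : CompleteSpace (fixedVectors h) := (isClosed_fixedVectors h).completeSpace_coe
  inferInstance

/-- The projection ξ of δ₁ is constant on the d powers of h, with value ξ(1) = ‖ξ‖². Hence d‖ξ‖⁴ ≤
‖ξ‖². For h of infinite order, `orderOf h` is 0 and the bound is trivial. -/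
theorem norm_starProjection_fixedVectors_le {h : G} :
    orderOf h * ‖(fixedVectors h).starProjection (delta 1)‖ ^ 2 ≤ 1 := by
  set ξ := (fixedVectors h).starProjection (delta 1) with hξ
  have hc : ξ 1 = ((‖ξ‖ ^ 2 : ℝ) : ℂ) := tau_starProjection (fixedVectors h)
  have hfix : leftRep G h ξ = ξ := mem_fixedVectors.1 (Submodule.starProjection_apply_mem _ _)
  have hpow : ∀ i : ℕ, ξ (h ^ i) = ξ 1 := fun i => by
    induction i with
    | zero => simp
    | succ i ih =>
      conv_lhs => rw [← hfix]
      rw [leftRep_apply, pow_succ', inv_mul_cancel_left, ih]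
  classical
  have hsum := lp.sum_rpow_le_norm_rpow (p := 2) (by simp) ξ
    ((Finset.range (orderOf h)).image fun i => h ^ i)
  rw [Finset.sum_image fun i hi j hj hij =>
    pow_injOn_Iio_orderOf (by simpa using hi) (by simpa using hj) hij] at hsum
  simp only [hpow, hc, Complex.norm_real, Finset.sum_const, Finset.card_range, nsmul_eq_mul,
    ENNReal.toReal_ofNat, Real.rpow_ofNat, norm_pow, norm_norm] at hsum
  rcases (norm_nonneg ξ).eq_or_lt with h0 | h0
  · rw [← h0]; simp
  · have : 0 < ‖ξ‖ ^ 2 := by positivity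
    nlinarith

theorem norm_tau_le {T : L2 G →L[ℂ] L2 G} (hT : IsRightInvariant T) {h : G}
    (hh : leftRep G h * T = T) {r : ℝ} (hr : 0 ≤ r) {f : ℂ[X]} (hf : f.Monic)
    (hfT : Polynomial.aeval T f = 0) (hroots : ∀ μ ∈ f.roots, ‖μ‖ ≤ r) :
    orderOf h * ‖tau G T‖ ≤ r := by
  have hTv : ∀ v, T v ∈ fixedVectors h := fun v => mem_fixedVectors.2 (by
    conv_rhs => rw [← hh]
    rfl)
  -- T maps the whole space into the fixed vectors, so a filtration step with μ = 0 shows that its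
  -- trace is already attained there.
  have hstep := tau_mul_starProjection_sub hT (isRightStable_fixedVectors h)
    (I := ⊤) (fun _ _ _ => trivial) le_top (μ := 0) fun v _ => by simpa using hTv v
  rw [zero_mul, Submodule.starProjection_top', mul_one, sub_eq_zero] at hstep
  have hprod : (f.roots.map fun μ => Polynomial.X - Polynomial.C μ).prod = f :=
    ((IsAlgClosed.splits f).eq_prod_roots_of_monic hf).symm
  have := norm_tau_mul_starProjection_le hT f.roots hroots (fixedVectors h)
    (isClosed_fixedVectors h) (isRightStable_fixedVectors h) (fun v _ => hTv v)
    (fun v _ => by rw [hprod, hfT]; rfl)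
  rw [hstep]
  calc _ ≤ (orderOf h : ℝ) * (r * ‖(fixedVectors h).starProjection (delta 1)‖ ^ 2) := by gcongr
    _ = r * (orderOf h * ‖(fixedVectors h).starProjection (delta 1)‖ ^ 2) := by ring
    _ ≤ r * 1 := by gcongr; exact norm_starProjection_fixedVectors_le
    _ = r := mul_one r

/-- An operator of large trace has a large spectral value, in the sense of polynomial relations. -/
theorem exists_common_root {T : L2 G →L[ℂ] L2 G} (hT : IsRightInvariant T) {h : G}
    (hh : leftRep G h * T = T) {c : ℝ} (hc : 0 < c) (hd : c ≤ orderOf h * ‖tau G T‖) :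
    ∃ z : ℂ, c ≤ ‖z‖ ∧ ∀ f : ℂ[X], Polynomial.aeval T f = 0 → f.eval z = 0 := by
  by_cases halg : IsIntegral ℂ T
  · by_contra! hcon
    have hroots : ∀ μ ∈ (minpoly ℂ T).roots, ‖μ‖ < c := fun μ hμ => by
      by_contra! hμc
      obtain ⟨f, hf, hfz⟩ := hcon μ hμc
      exact hfz ((Polynomial.isRoot_of_mem_roots hμ).dvd (minpoly.dvd ℂ T hf))
    -- The roots are finitely many, so the strict bounds by c give a uniform r < c; this contradicts
    -- the non-strict `hd`.
    obtain ⟨r, hr0, hrc, hr⟩ : ∃ r : ℝ, 0 ≤ r ∧ r < c ∧ ∀ μ ∈ (minpoly ℂ T).roots, ‖μ‖ ≤ r := by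
      generalize (minpoly ℂ T).roots = L at hroots
      induction L using Multiset.induction_on with
      | empty => exact ⟨0, le_rfl, hc, by simp⟩
      | cons μ L ih =>
        obtain ⟨r, h0, h1, h2⟩ := ih fun ν hν => hroots ν (Multiset.mem_cons_of_mem hν)
        refine ⟨max r ‖μ‖, le_max_of_le_left h0, max_lt h1 (hroots μ (Multiset.mem_cons_self _ _)),
          fun ν hν => ?_⟩
        rcases Multiset.mem_cons.1 hν with rfl | hν
        · exact le_max_right _ _
        · exact (h2 ν hν).trans (le_max_left _ _)
    exact absurd (norm_tau_le hT hh hr0 (minpoly.monic halg) (minpoly.aeval ℂ T) hr)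
      (not_le.2 (hrc.trans_le hd))
  -- Only the zero polynomial kills a transcendental T, so any z of modulus at least c will do.
  · refine ⟨c, by simp [abs_of_pos hc], fun f hf => ?_⟩
    have : f = 0 := by
      by_contra hf0
      exact halg (IsAlgebraic.isIntegral ⟨f, hf0, hf⟩)
    simp [this]

/-- The averaging operator `(1 / d) ∑ h ^ i` on `ℓ²(G)`. -/
noncomputable def averaging (h : G) : L2 G →L[ℂ] L2 G :=
  (orderOf h : ℂ)⁻¹ • ∑ i ∈ Finset.range (orderOf h), leftRep G h ^ i

theorem leftRep_mul_averaging (h : G) : leftRep G h * averaging h = averaging h := by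
  have := mul_neg_geom_sum (leftRep G h) (orderOf h)
  rw [← map_pow, pow_orderOf_eq_one, map_one, sub_self, sub_mul, one_mul, sub_eq_zero] at this
  rw [averaging, mul_smul_comm, ← this]

theorem mul_averaging {T : L2 G →L[ℂ] L2 G} {h : G} (hfin : IsOfFinOrder h)
    (hh : T * leftRep G h = T) : T * averaging h = T := by
  have hpow : ∀ i : ℕ, T * leftRep G h ^ i = T := fun i => by
    induction i with
    | zero => simp
    | succ i ih => rw [pow_succ, ← mul_assoc, ih, hh]
  rw [averaging, mul_smul_comm, Finset.mul_sum]
  simp only [hpow, Finset.sum_const, Finset.card_range]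
  rw [← Nat.cast_smul_eq_nsmul ℂ, smul_smul, inv_mul_cancel₀, one_smul]
  exact_mod_cast hfin.orderOf_pos.ne'

theorem isRightInvariant_averaging (h : G) : IsRightInvariant (averaging h) := by
  have : averaging h = Polynomial.aeval (leftRep G h)
      (Polynomial.C (orderOf h : ℂ)⁻¹ * ∑ i ∈ Finset.range (orderOf h), Polynomial.X ^ i) := by
    simp [averaging, Algebra.algebraMap_eq_smul_one]
  rw [this]
  exact (isRightInvariant_leftRep h).aeval _

/-- With e the averaging operator, eT is fixed by h on the left and has the trace of T. Since Te =
T, (eT)ⁿ = eTⁿ for n ≥ 1, so f(T) = 0 implies that Xf kills eT; the factor X is harmless because z ≠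
0. -/
theorem exists_common_root' {T : L2 G →L[ℂ] L2 G} (hT : IsRightInvariant T) {h : G}
    (hfin : IsOfFinOrder h) (hh : T * leftRep G h = T) {c : ℝ} (hc : 0 < c)
    (hd : c ≤ orderOf h * ‖tau G T‖) :
    ∃ z : ℂ, c ≤ ‖z‖ ∧ ∀ f : ℂ[X], Polynomial.aeval T f = 0 → f.eval z = 0 := by
  have he := isRightInvariant_averaging h
  have hTe := mul_averaging hfin hh
  have htau : tau G (averaging h * T) = tau G T := by rw [tau_mul_comm he hT, hTe]
  obtain ⟨z, hz, hzf⟩ := exists_common_root (he.mul hT)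
    (by rw [← mul_assoc, leftRep_mul_averaging]) hc (by rw [htau]; exact hd)
  refine ⟨z, hz, fun f hf => ?_⟩
  have hpow : ∀ n : ℕ, (averaging h * T) ^ (n + 1) = averaging h * T ^ (n + 1) := fun n => by
    induction n with
    | zero => simp
    | succ n ih =>
      rw [pow_succ, ih, pow_succ T (n + 1), mul_assoc, ← mul_assoc (T ^ (n + 1)), pow_succ T n,
        mul_assoc (T ^ n), hTe, ← mul_assoc]
  have hX : ∀ g : ℂ[X], Polynomial.aeval (averaging h * T) (g * Polynomial.X) =
      averaging h * Polynomial.aeval T (g * Polynomial.X) := fun g => by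
    induction g using Polynomial.induction_on' with
    | add p q hp hq => rw [add_mul, map_add, map_add, hp, hq, mul_add]
    | monomial n a =>
      rw [Polynomial.monomial_mul_X, Polynomial.aeval_monomial, Polynomial.aeval_monomial, hpow,
        Algebra.left_comm]
  have := hzf (f * Polynomial.X) (by rw [hX, map_mul, hf, zero_mul, mul_zero])
  rw [Polynomial.eval_mul, Polynomial.eval_X, mul_eq_zero] at this
  refine this.resolve_right fun h0 => ?_
  rw [h0, norm_zero] at hz
  exact absurd hz (not_le.2 hc)

end Spectral

open scoped Polynomial Pointwise Function

/-! ### Ping-pong for shears, and its transfer to algebras. -/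

section PingPong

/-- The elementary permutations `(x, y) ↦ (x + y, y)` and `(x, y) ↦ (x, y + t x)`. -/
def shear {S : Type*} [CommRing S] (t : S) : Bool → Equiv.Perm (S × S)
  | true =>
    { toFun := fun p => (p.1 + p.2, p.2)
      invFun := fun p => (p.1 - p.2, p.2)
      left_inv := fun p => by simp
      right_inv := fun p => by simp }
  | false =>
    { toFun := fun p => (p.1, p.2 + t * p.1)
      invFun := fun p => (p.1, p.2 - t * p.1)
      left_inv := fun p => by simp
      right_inv := fun p => by simp }

theorem shear_true_zpow {S : Type*} [CommRing S] (t : S) (n : ℤ) (p : S × S) :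
    (shear t true ^ n) p = (p.1 + n * p.2, p.2) := by
  induction n generalizing p with
  | zero => simp
  | succ n ih =>
    rw [zpow_add_one, Equiv.Perm.mul_apply, ih]
    simp only [shear, Equiv.coe_fn_mk, Prod.mk.injEq, and_true]
    push_cast; ring
  | pred n ih =>
    rw [zpow_sub_one, Equiv.Perm.mul_apply, ih]
    change (p.1 - p.2 + _ * p.2, p.2) = _
    simp only [Prod.mk.injEq, and_true]
    push_cast; ring

theorem shear_false_zpow {S : Type*} [CommRing S] (t : S) (n : ℤ) (p : S × S) :
    (shear t false ^ n) p = (p.1, p.2 + n * (t * p.1)) := by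
  induction n generalizing p with
  | zero => simp
  | succ n ih =>
    rw [zpow_add_one, Equiv.Perm.mul_apply, ih]
    simp only [shear, Equiv.coe_fn_mk, Prod.mk.injEq, true_and]
    push_cast; ring
  | pred n ih =>
    rw [zpow_sub_one, Equiv.Perm.mul_apply, ih]
    change (p.1, p.2 - t * p.1 + _ * (t * p.1)) = _
    simp only [Prod.mk.injEq, true_and]
    push_cast; ring

theorem one_le_norm_intCast {n : ℤ} (hn : n ≠ 0) : 1 ≤ ‖(n : ℂ)‖ := by
  rw [Complex.norm_intCast]
  exact_mod_cast Int.one_le_abs hn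

/-- For `‖z‖ ≥ 4` the two shears generate a free group. -/
theorem injective_lift_shear {z : ℂ} (hz : 4 ≤ ‖z‖) :
    Function.Injective (FreeGroup.lift (shear z)) := by
  have hcomp : FreeGroup.lift (shear z) =
      (Monoid.CoprodI.lift fun i => FreeGroup.lift fun _ : Unit => shear z i).comp
        (freeGroupEquivCoprodI (ι := Bool)).toMonoidHom := by
    ext i : 1
    simp
  rw [hcomp, MonoidHom.coe_comp]
  refine Function.Injective.comp ?_ (MulEquiv.injective freeGroupEquivCoprodI)
  -- Slope 2 suits both shears: for n ≠ 0, 2|x| < |y| gives |x + ny| ≥ |y| - |x| > |y|/2, and |y| <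
  -- 2|x| gives |y + nzx| ≥ 4|x| - |y| > 2|x|.
  let V : Bool → Set (ℂ × ℂ) := fun i =>
    bif i then {p | ‖p.2‖ < 2 * ‖p.1‖} else {p | 2 * ‖p.1‖ < ‖p.2‖}
  apply Monoid.CoprodI.lift_injective_of_ping_pong
    (fun i => FreeGroup.lift fun _ : Unit => shear z i) _ V
  · rintro (_ | _)
    · exact ⟨(0, 1), by simp [V]⟩
    · exact ⟨(1, 0), by simp [V]⟩
  · rintro (_ | _) (_ | _) hij
    · exact absurd rfl hij
    · exact Set.disjoint_left.2 fun p (hp : 2 * ‖p.1‖ < ‖p.2‖) hq => lt_asymm hp hq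
    · exact Set.disjoint_left.2 fun p (hp : ‖p.2‖ < 2 * ‖p.1‖) hq => lt_asymm hp hq
    · exact absurd rfl hij
  · intro i j hij
    refine FreeGroup.freeGroupUnitEquivInt.forall_congr_left.mpr fun n hn => ?_
    have hn0 : n ≠ 0 := by
      rintro rfl
      exact hn (by simp [FreeGroup.freeGroupUnitEquivInt])
    have hn1 := one_le_norm_intCast hn0
    change FreeGroup.lift (fun _ => shear z i) (FreeGroup.of () ^ n) • V j ⊆ V i
    rw [map_zpow, FreeGroup.lift_apply_of]
    rintro _ ⟨p, hp, rfl⟩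
    rcases i with _ | _ <;> rcases j with _ | _
    · exact absurd rfl hij
    · change ‖p.2‖ < 2 * ‖p.1‖ at hp
      change (shear z false ^ n) p ∈ V false
      rw [shear_false_zpow]
      change 2 * ‖p.1‖ < ‖p.2 + n * (z * p.1)‖
      have h1 : ‖(n : ℂ) * (z * p.1)‖ ≤ ‖p.2 + n * (z * p.1)‖ + ‖p.2‖ := by
        simpa using norm_sub_le (p.2 + n * (z * p.1)) p.2
      rw [norm_mul, norm_mul] at h1
      have h2 : 1 * (4 * ‖p.1‖) ≤ ‖(n : ℂ)‖ * (‖z‖ * ‖p.1‖) := by gcongr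
      linarith
    · change 2 * ‖p.1‖ < ‖p.2‖ at hp
      change (shear z true ^ n) p ∈ V true
      rw [shear_true_zpow]
      change ‖p.2‖ < 2 * ‖p.1 + n * p.2‖
      have h1 : ‖(n : ℂ) * p.2‖ ≤ ‖p.1 + n * p.2‖ + ‖p.1‖ := by
        simpa using norm_sub_le (p.1 + n * p.2) p.1
      rw [norm_mul] at h1
      have h2 : 1 * ‖p.2‖ ≤ ‖(n : ℂ)‖ * ‖p.2‖ := by gcongr
      linarith
    · exact absurd rfl hij
  -- With only two factors, the ping-pong lemma asks for a factor with at least three elements; here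
  -- it is infinite cyclic.
  · right
    refine ⟨true, ?_⟩
    rw [FreeGroup.freeGroupUnitEquivInt.cardinal_eq, Cardinal.mk_denumerable]
    exact Cardinal.natCast_le_aleph0

/-- A map intertwining two families of permutations intertwines all words in them. -/
theorem intertwine_lift {ι X Y : Type*} (F : X → Y) (f : ι → Equiv.Perm X) (g : ι → Equiv.Perm Y)
    (h : ∀ i x, F (f i x) = g i (F x)) (w : FreeGroup ι) (x : X) :
    F (FreeGroup.lift f w x) = FreeGroup.lift g w (F x) := by
  induction w using FreeGroup.induction_on generalizing x with
  | C1 => simp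
  | of i => simpa using h i x
  | inv_of i _ =>
    rw [map_inv, map_inv, FreeGroup.lift_apply_of, FreeGroup.lift_apply_of,
      Equiv.Perm.eq_inv_iff_eq, ← h]
    exact congrArg F ((f i).apply_symm_apply x)
  | mul u v hu hv => rw [map_mul, map_mul, Equiv.Perm.mul_apply, Equiv.Perm.mul_apply, hu, hv]

/-- If `a² = b² = 0` and some `z` with `‖z‖ ≥ 4` is a root of all polynomials killing `ab`,
then `1 + a` and `1 + b` generate freely. -/
theorem injective_lift_of_common_root {A : Type*} [Ring A] [Algebra ℂ A] {a b : A}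
    (ha : a * a = 0) (hb : b * b = 0) {z : ℂ} (hz : 4 ≤ ‖z‖)
    (hroot : ∀ f : ℂ[X], Polynomial.aeval (a * b) f = 0 → f.eval z = 0)
    (u : Bool → Aˣ) (hu : (u true : A) = 1 + a) (hv : (u false : A) = 1 + b) :
    Function.Injective (FreeGroup.lift u) := by
  rw [injective_iff_map_eq_one]
  intro w hw
  apply injective_lift_shear hz
  rw [map_one]
  let φ : ℂ[X] →ₐ[ℂ] A := Polynomial.aeval (a * b)
  -- Left multiplication by 1 + a and 1 + b on the image of F corresponds to the shears with t = X.
  let F : ℂ[X] × ℂ[X] → A := fun p => a * b * φ p.1 + b * φ p.2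
  have hz0 : z ≠ 0 := fun h => by simp [h] at hz; linarith
  have hφX : φ Polynomial.X = a * b := Polynomial.aeval_X _
  have key : ∀ p, F (FreeGroup.lift (shear (Polynomial.X : ℂ[X])) w p) = F p := by
    intro p
    have h := intertwine_lift F (shear (Polynomial.X : ℂ[X]))
      (fun i => MulAction.toPermHom Aˣ A (u i)) (by
        rintro (_ | _) p
        · change a * b * φ p.1 + b * φ (p.2 + Polynomial.X * p.1) =
            (u false : A) * (a * b * φ p.1 + b * φ p.2)
          rw [hv, map_add, map_mul, hφX]
          have : b * (b * φ p.2) = 0 := by rw [← mul_assoc, hb, zero_mul]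
          simp only [add_mul, mul_add, one_mul, this]
          abel
        · change a * b * φ (p.1 + p.2) + b * φ p.2 = (u true : A) * (a * b * φ p.1 + b * φ p.2)
          rw [hu, map_add]
          have : a * (a * (b * φ p.1)) = 0 := by rw [← mul_assoc, ha, zero_mul]
          simp only [add_mul, mul_add, one_mul, mul_assoc, this]
          abel) w p
    rw [h]
    have : FreeGroup.lift (fun i => MulAction.toPermHom Aˣ A (u i)) =
        (MulAction.toPermHom Aˣ A).comp (FreeGroup.lift u) := by
      ext i : 1
      simp
    rw [this, MonoidHom.comp_apply, hw, map_one, Equiv.Perm.one_apply]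
  -- F need not be injective, but it determines the values at z: multiplying by a kills the first
  -- term and multiplying by ab kills the second. What remains is Xq or X²p evaluated at ab, and z ≠
  -- 0.
  have hF : ∀ p q, F p = F q → (p.1.eval z = q.1.eval z ∧ p.2.eval z = q.2.eval z) := by
    intro p q hpq
    have h0 : a * b * φ (p.1 - q.1) + b * φ (p.2 - q.2) = 0 := by
      rw [map_sub, map_sub, mul_sub, mul_sub]
      rw [sub_add_sub_comm]
      exact sub_eq_zero.2 hpq
    have h2 := congrArg (a * ·) h0
    have h1 := congrArg (a * b * ·) h0
    simp only [mul_zero, mul_add] at h1 h2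
    have e1 : a * (a * b * φ (p.1 - q.1)) = 0 := by rw [← mul_assoc, ← mul_assoc, ha]; simp
    have e2 : a * b * (b * φ (p.2 - q.2)) = 0 := by
      rw [← mul_assoc, mul_assoc a, hb]; simp
    rw [e1, zero_add, ← mul_assoc, ← hφX, ← map_mul] at h2
    rw [e2, add_zero, ← hφX, ← map_mul, ← map_mul] at h1
    have h1' := hroot _ h1
    have h2' := hroot _ h2
    simp only [Polynomial.eval_mul, Polynomial.eval_X, Polynomial.eval_sub, mul_eq_zero, hz0,
      false_or, sub_eq_zero] at h1' h2'
    exact ⟨h1', h2'⟩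
  let ev : ℂ[X] × ℂ[X] → ℂ × ℂ := fun p => (p.1.eval z, p.2.eval z)
  ext1 v
  have hev : ev (Polynomial.C v.1, Polynomial.C v.2) = v := by simp [ev]
  have h := intertwine_lift ev (shear (Polynomial.X : ℂ[X])) (shear z)
    (by rintro (_ | _) p <;> simp [ev, shear]) w (Polynomial.C v.1, Polynomial.C v.2)
  rw [hev] at h
  rw [← h, Equiv.Perm.one_apply]
  conv_rhs => rw [← hev]
  exact Prod.ext_iff.2 (hF _ _ (key _))

/-- Two elements that generate freely form a free pair. -/
theorem isFreePair_of_injective {U : Type*} [Group U] (u : Bool → U)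
    (h : Function.Injective (FreeGroup.lift u)) : IsFreePair (u true) (u false) := by
  have hrange : (FreeGroup.lift u).range = Subgroup.closure {u true, u false} := by
    rw [FreeGroup.range_lift_eq_closure]
    congr 1
    ext x
    simp [or_comm]
  refine ⟨?_, ⟨u true, Subgroup.subset_closure (by simp)⟩,
    ⟨u false, Subgroup.subset_closure (by simp)⟩, fun hcomm => ?_⟩
  · rw [← hrange]
    exact IsFreeGroup.ofMulEquiv (MonoidHom.ofInjective h)
  · have h1 : FreeGroup.of true * FreeGroup.of false = FreeGroup.of false * FreeGroup.of true := by
      apply h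
      simpa using congrArg Subtype.val hcomm
    exact absurd (congrArg FreeGroup.toWord h1) (by decide)

theorem IsFreePair.symm {U : Type*} [Group U] {u v : U} (h : IsFreePair u v) : IsFreePair v u := by
  unfold IsFreePair at h ⊢
  rwa [Set.pair_comm]

end PingPong

/-! ### The regular representation of ℤG and the trace criterion for free pairs. -/

section GroupRing

variable {G : Type*} [Group G]

/-- The left regular representation of `ℤG` on `ℓ²(G)`. -/
noncomputable def regRep (G : Type*) [Group G] : MonoidAlgebra ℤ G →ₐ[ℤ] (L2 G →L[ℂ] L2 G) :=
  MonoidAlgebra.lift ℤ _ G (leftRep G)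

theorem regRep_of (g : G) : regRep G (MonoidAlgebra.of ℤ G g) = leftRep G g :=
  MonoidAlgebra.lift_of _ _

theorem isRightInvariant_regRep (x : MonoidAlgebra ℤ G) : IsRightInvariant (regRep G x) := by
  induction x using MonoidAlgebra.induction_on with
  | of g => rw [regRep_of]; exact isRightInvariant_leftRep g
  | add x y hx hy => intro g ξ; simp [hx g ξ, hy g ξ]
  | smul n x hx => intro g ξ; simp [hx g ξ]

/-- The coefficient of `1`, as a complex number. -/
noncomputable def coeffOne (G : Type*) [Group G] : MonoidAlgebra ℤ G →+ ℂ :=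
  (tau G).toAddMonoidHom.comp (regRep G : MonoidAlgebra ℤ G →+ (L2 G →L[ℂ] L2 G))

theorem coeffOne_eq_tau (x : MonoidAlgebra ℤ G) : coeffOne G x = tau G (regRep G x) := rfl

theorem coeffOne_mul_comm (x y : MonoidAlgebra ℤ G) : coeffOne G (x * y) = coeffOne G (y * x) := by
  rw [coeffOne_eq_tau, coeffOne_eq_tau, map_mul (regRep G), map_mul (regRep G),
    tau_mul_comm (isRightInvariant_regRep x) (isRightInvariant_regRep y)]

theorem coeffOne_of_one : coeffOne G (MonoidAlgebra.of ℤ G 1) = 1 := by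
  rw [coeffOne_eq_tau, regRep_of, map_one]
  exact delta_apply_self 1

theorem coeffOne_of_ne {g : G} (hg : g ≠ 1) : coeffOne G (MonoidAlgebra.of ℤ G g) = 0 := by
  rw [coeffOne_eq_tau, regRep_of]
  exact delta_apply_of_ne (by simpa using hg)

theorem coeffOne_of_re_nonneg (g : G) : 0 ≤ (coeffOne G (MonoidAlgebra.of ℤ G g)).re := by
  by_cases hg : g = 1
  · rw [hg, coeffOne_of_one]; simp
  · rw [coeffOne_of_ne hg]; simp

theorem injective_lift_of_map {U V : Type*} [Group U] [Group V] (f : U →* V) (u : Bool → U)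
    (h : Function.Injective (FreeGroup.lift fun i => f (u i))) :
    Function.Injective (FreeGroup.lift u) := by
  have : FreeGroup.lift (fun i => f (u i)) = f.comp (FreeGroup.lift u) := by
    ext i : 1
    simp
  rw [this, MonoidHom.coe_comp] at h
  exact h.of_comp

/-- Two units `1 + a` and `1 + b` with `a² = b² = 0` form a free pair if some polynomial spectral
value of `ab` is large. -/
theorem isFreePair_of_common_root {u v : (MonoidAlgebra ℤ G)ˣ} {a b : MonoidAlgebra ℤ G}
    (hu : (u : MonoidAlgebra ℤ G) = 1 + a) (hv : (v : MonoidAlgebra ℤ G) = 1 + b)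
    (ha : a * a = 0) (hb : b * b = 0)
    (h : ∃ z : ℂ, 4 ≤ ‖z‖ ∧
      ∀ f : Polynomial ℂ, Polynomial.aeval (regRep G (a * b)) f = 0 → f.eval z = 0) :
    IsFreePair u v := by
  obtain ⟨z, hz, hroot⟩ := h
  rw [map_mul] at hroot
  refine isFreePair_of_injective (fun i => bif i then u else v)
    (injective_lift_of_map (Units.map (regRep G).toMonoidHom) _ ?_)
  refine injective_lift_of_common_root (a := regRep G a) (b := regRep G b) ?_ ?_ hz hroot _ ?_ ?_
  · rw [← map_mul, ha, map_zero]
  · rw [← map_mul, hb, map_zero]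
  · simp [hu]
  · simp [hv]

theorem isFreePair_of_left_fixed {u v : (MonoidAlgebra ℤ G)ˣ} {a b : MonoidAlgebra ℤ G}
    (hu : (u : MonoidAlgebra ℤ G) = 1 + a) (hv : (v : MonoidAlgebra ℤ G) = 1 + b)
    (ha : a * a = 0) (hb : b * b = 0) {h : G} (hha : MonoidAlgebra.of ℤ G h * a = a)
    (hd : 4 ≤ orderOf h * ‖coeffOne G (a * b)‖) : IsFreePair u v := by
  refine isFreePair_of_common_root hu hv ha hb
    (exists_common_root (isRightInvariant_regRep _) (h := h) ?_ (by norm_num) hd)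
  rw [← regRep_of, ← map_mul, ← mul_assoc, hha]

/-- Here h fixes ba on the right, and ba has the same trace as ab, so the roles of a and b are
exchanged. -/
theorem isFreePair_of_right_fixed {u v : (MonoidAlgebra ℤ G)ˣ} {a b : MonoidAlgebra ℤ G}
    (hu : (u : MonoidAlgebra ℤ G) = 1 + a) (hv : (v : MonoidAlgebra ℤ G) = 1 + b)
    (ha : a * a = 0) (hb : b * b = 0) {h : G} (hfin : IsOfFinOrder h)
    (hha : a * MonoidAlgebra.of ℤ G h = a)
    (hd : 4 ≤ orderOf h * ‖coeffOne G (a * b)‖) : IsFreePair u v := by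
  rw [coeffOne_mul_comm] at hd
  refine (isFreePair_of_common_root hv hu hb ha
    (exists_common_root' (isRightInvariant_regRep _) hfin ?_ (by norm_num) hd)).symm
  rw [← regRep_of, ← map_mul, mul_assoc, hha]

/-! ### Cyclic sums and lower bounds for traces. -/

theorem of_mul_cyclicSum_self (h : G) : MonoidAlgebra.of ℤ G h * cyclicSum h = cyclicSum h := by
  have : (1 - MonoidAlgebra.of ℤ G h) * cyclicSum h = 0 := by
    rw [cyclicSum, mul_neg_geom_sum, ← map_pow, pow_orderOf_eq_one, map_one, sub_self]
  rw [sub_mul, one_mul, sub_eq_zero] at this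
  exact this.symm

theorem cyclicSum_mul_of_self (h : G) : cyclicSum h * MonoidAlgebra.of ℤ G h = cyclicSum h := by
  have := cyclicSum_mul_one_sub h
  rw [mul_sub, mul_one, sub_eq_zero] at this
  exact this.symm

theorem of_pow_mul_cyclicSum (k : G) (n : ℕ) :
    MonoidAlgebra.of ℤ G k ^ n * cyclicSum k = cyclicSum k := by
  induction n with
  | zero => simp
  | succ n ih => rw [pow_succ, mul_assoc, of_mul_cyclicSum_self, ih]

theorem of_mul_cyclicSum {k g : G} (hk : IsOfFinOrder k) (hg : g ∈ Subgroup.zpowers k) :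
    MonoidAlgebra.of ℤ G g * cyclicSum k = cyclicSum k := by
  obtain ⟨n, rfl⟩ := hk.mem_powers_iff_mem_zpowers.2 hg
  rw [map_pow, of_pow_mul_cyclicSum]

theorem cyclicSum_mul_self (k : G) : cyclicSum k * cyclicSum k = orderOf k • cyclicSum k := by
  conv_lhs =>
    enter [1]
    rw [cyclicSum]
  rw [Finset.sum_mul]
  simp only [of_pow_mul_cyclicSum, Finset.sum_const, Finset.card_range]

theorem orderOf_conj_eq (x h : G) : orderOf (x * h * x⁻¹) = orderOf h :=
  (MulAut.conj x).orderOf_eq h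

theorem isOfFinOrder_conj {h : G} (hh : IsOfFinOrder h) (x : G) : IsOfFinOrder (x * h * x⁻¹) := by
  rw [← orderOf_pos_iff, orderOf_conj_eq]
  exact hh.orderOf_pos

/-- Lets both nilpotent parts be written with the single cyclic sum k̂ of k = xhx⁻¹. -/
theorem of_mul_cyclicSum_eq_conj (x h : G) :
    MonoidAlgebra.of ℤ G x * cyclicSum h =
      cyclicSum (x * h * x⁻¹) * MonoidAlgebra.of ℤ G x := by
  rw [cyclicSum, cyclicSum, orderOf_conj_eq, Finset.mul_sum, Finset.sum_mul]
  refine Finset.sum_congr rfl fun i _ => ?_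
  rw [← map_pow, ← map_pow, ← map_mul, ← map_mul, conj_pow, inv_mul_cancel_right]

theorem coeffOne_cyclicSum_mul_of {k g : G} (hg : g ∉ Subgroup.zpowers k) :
    coeffOne G (cyclicSum k * MonoidAlgebra.of ℤ G g) = 0 := by
  rw [cyclicSum, Finset.sum_mul, map_sum]
  refine Finset.sum_eq_zero fun i _ => ?_
  rw [← map_pow, ← map_mul]
  refine coeffOne_of_ne fun h => hg ?_
  rw [← inv_eq_of_mul_eq_one_right h]
  exact inv_mem (Subgroup.npow_mem_zpowers k i)

theorem coeffOne_cyclicSum {k : G} (hk : IsOfFinOrder k) : coeffOne G (cyclicSum k) = 1 := by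
  rw [cyclicSum, map_sum, Finset.sum_eq_single_of_mem 0 (Finset.mem_range.2 hk.orderOf_pos)]
  · rw [pow_zero, ← map_one (MonoidAlgebra.of ℤ G), coeffOne_of_one]
  · intro i hi hi0
    rw [← map_pow]
    exact coeffOne_of_ne (pow_ne_one_of_lt_orderOf hi0 (Finset.mem_range.1 hi))

theorem coeffOne_cyclicSum_mul_of_re_nonneg (k g : G) :
    0 ≤ (coeffOne G (cyclicSum k * MonoidAlgebra.of ℤ G g)).re := by
  rw [cyclicSum, Finset.sum_mul, map_sum, Complex.re_sum]
  refine Finset.sum_nonneg fun i _ => ?_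
  rw [← map_pow, ← map_mul]
  exact coeffOne_of_re_nonneg _

/-- Of the four terms, k̂² = dk̂ contributes d, the two with a minus sign have trace 0 because g, l
∉ ⟨k⟩, and the last has nonnegative coefficients. -/
theorem orderOf_le_coeffOne_re {k g l : G} (hk : IsOfFinOrder k) (hg : g ∉ Subgroup.zpowers k)
    (hl : l ∉ Subgroup.zpowers k) :
    (orderOf k : ℝ) ≤ (coeffOne G (cyclicSum k * (1 - MonoidAlgebra.of ℤ G g) *
      (cyclicSum k * (1 - MonoidAlgebra.of ℤ G l)))).re := by
  have e : cyclicSum k * (1 - MonoidAlgebra.of ℤ G g) *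
      (cyclicSum k * (1 - MonoidAlgebra.of ℤ G l)) =
      cyclicSum k * cyclicSum k - cyclicSum k * MonoidAlgebra.of ℤ G g * cyclicSum k
        - cyclicSum k * cyclicSum k * MonoidAlgebra.of ℤ G l +
        cyclicSum k * MonoidAlgebra.of ℤ G g * cyclicSum k * MonoidAlgebra.of ℤ G l := by
    noncomm_ring
  have h2 : coeffOne G (cyclicSum k * MonoidAlgebra.of ℤ G g * cyclicSum k) = 0 := by
    rw [coeffOne_mul_comm, ← mul_assoc, cyclicSum_mul_self, smul_mul_assoc, map_nsmul,
      coeffOne_cyclicSum_mul_of hg, smul_zero]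
  have h4 : 0 ≤ (coeffOne G (cyclicSum k * MonoidAlgebra.of ℤ G g * cyclicSum k *
      MonoidAlgebra.of ℤ G l)).re := by
    conv in (occs := 2) cyclicSum k => rw [cyclicSum]
    rw [Finset.mul_sum, Finset.sum_mul, map_sum, Complex.re_sum]
    refine Finset.sum_nonneg fun i _ => ?_
    rw [← map_pow, mul_assoc, mul_assoc, ← map_mul, ← map_mul]
    exact coeffOne_cyclicSum_mul_of_re_nonneg _ _
  rw [e, map_add, map_sub, map_sub, h2, cyclicSum_mul_self, smul_mul_assoc, map_nsmul, map_nsmul,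
    coeffOne_cyclicSum hk, coeffOne_cyclicSum_mul_of hl]
  simpa using h4

theorem coeffOne_sq_re {k g : G} (hk : IsOfFinOrder k) (hg : g ∉ Subgroup.zpowers k) :
    (orderOf k : ℝ) ≤ (coeffOne G (cyclicSum k * cyclicSum k * (1 - MonoidAlgebra.of ℤ G g) *
      (1 - MonoidAlgebra.of ℤ G g))).re := by
  have e : cyclicSum k * (1 - MonoidAlgebra.of ℤ G g) * (1 - MonoidAlgebra.of ℤ G g) =
      cyclicSum k - 2 • (cyclicSum k * MonoidAlgebra.of ℤ G g)
        + cyclicSum k * MonoidAlgebra.of ℤ G (g * g) := by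
    rw [map_mul]
    noncomm_ring
  have h := coeffOne_cyclicSum_mul_of_re_nonneg k (g * g)
  rw [cyclicSum_mul_self, smul_mul_assoc, smul_mul_assoc, map_nsmul, e, map_add, map_sub, map_nsmul,
    coeffOne_cyclicSum hk, coeffOne_cyclicSum_mul_of hg]
  simp only [smul_zero, sub_zero, nsmul_eq_mul, Complex.mul_re, Complex.natCast_re,
    Complex.natCast_im, zero_mul, Complex.add_re, Complex.one_re]
  nlinarith [Nat.cast_nonneg (α := ℝ) (orderOf k)]

/-- Otherwise, undoing the conjugation by x gives k ∈ ⟨h⟩. As h and k have the same finite order,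
⟨k⟩ = ⟨h⟩, contrary to h ∉ ⟨k⟩. -/
theorem notMem_zpowers_conj {h x : G} (hh : IsOfFinOrder h)
    (hx : h ∉ Subgroup.zpowers (x * h * x⁻¹)) :
    x * (x * h * x⁻¹) * x⁻¹ ∉ Subgroup.zpowers (x * h * x⁻¹) := fun hmem => by
  apply hx
  have h1 : x * h * x⁻¹ ∈ Subgroup.zpowers h := by
    obtain ⟨n, hn⟩ := Subgroup.mem_zpowers_iff.1 hmem
    refine Subgroup.mem_zpowers_iff.2 ⟨n, ?_⟩
    rw [conj_zpow] at hn
    exact mul_left_cancel (mul_right_cancel hn)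
  have : Finite (Subgroup.zpowers h) := hh.finite_zpowers
  rw [Subgroup.eq_of_le_of_card_ge (Subgroup.zpowers_le.2 h1)
    (by rw [Nat.card_zpowers, Nat.card_zpowers, orderOf_conj_eq])]
  exact Subgroup.mem_zpowers h

theorem four_le_of_orderOf_le {h : G} (hh : IsOfFinOrder h) (h1 : h ≠ 1) {c : ℂ}
    (hc : (orderOf h : ℝ) ≤ c.re) : 4 ≤ orderOf h * ‖c‖ := by
  have h2 : (2 : ℝ) ≤ orderOf h := by
    have := hh.orderOf_pos
    have := mt orderOf_eq_one_iff.1 h1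
    exact_mod_cast (by omega : 2 ≤ orderOf h)
  have h3 := hc.trans (Complex.re_le_norm c)
  nlinarith

/-! ### Bicyclic units in terms of k = xhx⁻¹, and the three free pairs. -/

theorem betaNil_eq (x h : G) : betaNil x h =
    (1 - MonoidAlgebra.of ℤ G h) * cyclicSum (x * h * x⁻¹) * MonoidAlgebra.of ℤ G x := by
  rw [betaNil, mul_assoc, of_mul_cyclicSum_eq_conj, ← mul_assoc]

theorem gammaNil_eq (x h : G) : gammaNil x⁻¹ h =
    MonoidAlgebra.of ℤ G x⁻¹ * (cyclicSum (x * h * x⁻¹) * (1 - MonoidAlgebra.of ℤ G h)) := by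
  have := of_mul_cyclicSum_eq_conj x⁻¹ (x * h * x⁻¹)
  rw [show x⁻¹ * (x * h * x⁻¹) * x⁻¹⁻¹ = h by group] at this
  rw [gammaNil, ← this, mul_assoc]

theorem betaNil_mul_of (x h : G) : betaNil x h * MonoidAlgebra.of ℤ G h = betaNil x h := by
  rw [betaNil, mul_assoc, cyclicSum_mul_of_self]

theorem of_mul_gammaNil (x h : G) : MonoidAlgebra.of ℤ G h * gammaNil x h = gammaNil x h := by
  rw [gammaNil, ← mul_assoc, ← mul_assoc, of_mul_cyclicSum_self]

/-- If h ∈ ⟨k⟩, then (1 - h)k̂ = 0. -/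
theorem notMem_of_beta_ne_one {x h : G} (hh : IsOfFinOrder h) (hne : beta x h ≠ 1) :
    h ∉ Subgroup.zpowers (x * h * x⁻¹) := fun hmem => hne <| Units.ext <| by
  change 1 + betaNil x h = 1
  rw [betaNil_eq, sub_mul, one_mul, of_mul_cyclicSum (isOfFinOrder_conj hh x) hmem, sub_self,
    zero_mul, add_zero]

theorem cyclicSum_mul_of {k g : G} (hk : IsOfFinOrder k) (hg : g ∈ Subgroup.zpowers k) :
    cyclicSum k * MonoidAlgebra.of ℤ G g = cyclicSum k := by
  obtain ⟨n, rfl⟩ := hk.mem_powers_iff_mem_zpowers.2 hg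
  rw [map_pow]
  induction n with
  | zero => simp
  | succ n ih =>
    rw [pow_succ, ← mul_assoc, ih (Subgroup.npow_mem_zpowers k n), cyclicSum_mul_of_self]

theorem notMem_of_gamma_ne_one {x h : G} (hh : IsOfFinOrder h) (hne : gamma x⁻¹ h ≠ 1) :
    h ∉ Subgroup.zpowers (x * h * x⁻¹) := fun hmem => hne <| Units.ext <| by
  change 1 + gammaNil x⁻¹ h = 1
  rw [gammaNil_eq, mul_sub, mul_one, cyclicSum_mul_of (isOfFinOrder_conj hh x) hmem, sub_self,
    mul_zero, add_zero]

theorem ne_one_of_notMem {h : G} {H : Subgroup G} (hH : h ∉ H) : h ≠ 1 := fun h1 =>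
  hH (h1 ▸ H.one_mem)

/-- `β_{x,h}` and `γ_{x⁻¹,h}` form a free pair. -/
theorem isFreePair_beta_gamma {x h : G} (hh : IsOfFinOrder h)
    (hx : h ∉ Subgroup.zpowers (x * h * x⁻¹)) : IsFreePair (beta x h) (gamma x⁻¹ h) := by
  refine isFreePair_of_right_fixed (a := betaNil x h) (b := gammaNil x⁻¹ h) rfl rfl
    (betaNil_mul_self _ _) (gammaNil_mul_self _ _) hh (betaNil_mul_of x h)
    (four_le_of_orderOf_le hh (ne_one_of_notMem hx) ?_)
  have e : betaNil x h * gammaNil x⁻¹ h = (1 - MonoidAlgebra.of ℤ G h) *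
      (cyclicSum (x * h * x⁻¹) * cyclicSum (x * h * x⁻¹) * (1 - MonoidAlgebra.of ℤ G h)) := by
    have h1 : MonoidAlgebra.of ℤ G x * MonoidAlgebra.of ℤ G x⁻¹ = 1 := by
      rw [← map_mul, mul_inv_cancel, map_one]
    rw [betaNil_eq, gammaNil_eq, mul_assoc _ (MonoidAlgebra.of ℤ G x),
      ← mul_assoc (MonoidAlgebra.of ℤ G x), h1, one_mul]
    simp only [mul_assoc]
  rw [e, coeffOne_mul_comm, ← orderOf_conj_eq x h]
  exact coeffOne_sq_re (isOfFinOrder_conj hh x) hx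

/-- `β_{x,h}` and `β_{x⁻¹,k}` with `k = x h x⁻¹` form a free pair. -/
theorem isFreePair_beta_beta {x h : G} (hh : IsOfFinOrder h)
    (hx : h ∉ Subgroup.zpowers (x * h * x⁻¹)) :
    IsFreePair (beta x h) (beta x⁻¹ (x * h * x⁻¹)) := by
  refine isFreePair_of_right_fixed (a := betaNil x h) (b := betaNil x⁻¹ (x * h * x⁻¹)) rfl rfl
    (betaNil_mul_self _ _) (betaNil_mul_self _ _) hh (betaNil_mul_of x h)
    (four_le_of_orderOf_le hh (ne_one_of_notMem hx) ?_)
  have hk := orderOf_le_coeffOne_re (isOfFinOrder_conj hh x) hx (notMem_zpowers_conj hh hx)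
  rw [orderOf_conj_eq] at hk
  -- With l = xkx⁻¹ the product of the nilpotent parts is (1 - h)k̂(1 - l)k̂, a cyclic rotation of
  -- the element bounded in `hk`.
  have h1 : MonoidAlgebra.of ℤ G x * (1 - MonoidAlgebra.of ℤ G (x * h * x⁻¹)) *
      MonoidAlgebra.of ℤ G x⁻¹ = 1 - MonoidAlgebra.of ℤ G (x * (x * h * x⁻¹) * x⁻¹) := by
    rw [mul_sub, sub_mul, mul_one, ← map_mul, ← map_mul, ← map_mul, mul_inv_cancel, map_one]
  rw [← h1, mul_assoc, coeffOne_mul_comm] at hk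
  rw [betaNil_eq x h, betaNil]
  simpa only [mul_assoc] using hk

/-- `γ_{x⁻¹,h}` and `γ_{x,k}` with `k = x h x⁻¹` form a free pair. -/
theorem isFreePair_gamma_gamma {x h : G} (hh : IsOfFinOrder h)
    (hx : h ∉ Subgroup.zpowers (x * h * x⁻¹)) :
    IsFreePair (gamma x⁻¹ h) (gamma x (x * h * x⁻¹)) := by
  refine isFreePair_of_left_fixed (a := gammaNil x⁻¹ h) (b := gammaNil x (x * h * x⁻¹)) rfl rfl
    (gammaNil_mul_self _ _) (gammaNil_mul_self _ _) (of_mul_gammaNil x⁻¹ h)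
    (four_le_of_orderOf_le hh (ne_one_of_notMem hx) ?_)
  have hk := orderOf_le_coeffOne_re (isOfFinOrder_conj hh x) hx (notMem_zpowers_conj hh hx)
  rw [orderOf_conj_eq] at hk
  have h1 : MonoidAlgebra.of ℤ G x * (1 - MonoidAlgebra.of ℤ G (x * h * x⁻¹)) *
      MonoidAlgebra.of ℤ G x⁻¹ = 1 - MonoidAlgebra.of ℤ G (x * (x * h * x⁻¹) * x⁻¹) := by
    rw [mul_sub, sub_mul, mul_one, ← map_mul, ← map_mul, ← map_mul, mul_inv_cancel, map_one]
  rw [← h1, ← mul_assoc, ← mul_assoc, coeffOne_mul_comm] at hk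
  rw [gammaNil_eq x h, gammaNil]
  simpa only [mul_assoc] using hk

end GroupRing

end BicyclicUnits

theorem mainTheorem2 {G : Type*} [Group G] (α : (MonoidAlgebra ℤ G)ˣ)
    (hα : BicyclicUnits.IsBicyclic α) (hα1 : α ≠ 1) :
    ∃ β γ : (MonoidAlgebra ℤ G)ˣ,
      BicyclicUnits.IsBetaType β ∧ BicyclicUnits.IsGammaType γ ∧
        BicyclicUnits.IsFreePair α β ∧ BicyclicUnits.IsFreePair α γ := by
  rcases hα with ⟨x, h, hh, rfl⟩ | ⟨x, h, hh, rfl⟩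
  · have hx := BicyclicUnits.notMem_of_beta_ne_one hh hα1
    exact ⟨BicyclicUnits.beta x⁻¹ (x * h * x⁻¹), BicyclicUnits.gamma x⁻¹ h,
      ⟨_, _, BicyclicUnits.isOfFinOrder_conj hh x, rfl⟩,
      ⟨_, _, hh, rfl⟩, BicyclicUnits.isFreePair_beta_beta hh hx,
      BicyclicUnits.isFreePair_beta_gamma hh hx⟩
  -- Writing γ_{x,h} as γ_{y⁻¹,h} makes k = yhy⁻¹ play the same role as for type β.
  · obtain ⟨y, rfl⟩ : ∃ y, x = y⁻¹ := ⟨x⁻¹, (inv_inv x).symm⟩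
    have hx := BicyclicUnits.notMem_of_gamma_ne_one hh hα1
    exact ⟨BicyclicUnits.beta y h, BicyclicUnits.gamma y (y * h * y⁻¹), ⟨_, _, hh, rfl⟩,
      ⟨_, _, BicyclicUnits.isOfFinOrder_conj hh y, rfl⟩,
      (BicyclicUnits.isFreePair_beta_gamma hh hx).symm,
      BicyclicUnits.isFreePair_gamma_gamma hh hx⟩
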